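/- All graphs are finite and simple. A graph is *chordal* if it has no induced cycle $C_n$ with $n\ge 4$, and $\omega$ denotes the clique number. A graph $H$ is a *partial $k$-tree* if it is a subgraph of a chordal graph $H'$ with $V(H')=V(H)$ and $\omega(H')=k+1$. In the *$k$-clique-relaxed coloring game* on a graph $H$ with a fixed set of $n$ colors, Alice and Bob, starting with Alice, alternately choose an uncolored vertex of $H$ and give it one of the $n$ colors, in such a way that at no point does there exist a monochromatic $(k+1)$-clique. Alice wins if the game terminates with all vertices colored; otherwise (some vertex is uncolored and the player to move has no legal move) Bob wins. The *$k$-clique-relaxed game chromatic number* $\chi_{\mathrm g}^{(k)}(H)$ is the smallest $n$ for which Alice has a winning strategy with $n$ colors. **Statement.** Let $k\ge 1$ and let $H$ be a partial $k$-tree. Then Alice has a winning strategy in the $k$-clique-relaxed coloring game on $H$ with $4$ colors; in particular $\chi_{\mathrm g}^{(k)}(H)\le 4$. -/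

import Mathlib

namespace CliqueRelaxedGame

/-- A graph is chordal if no cycle on at least four vertices is an induced subgraph of it. -/
def IsChordal {V : Type*} (H : SimpleGraph V) : Prop :=
  ∀ n : ℕ, 4 ≤ n → ¬ (SimpleGraph.cycleGraph n).IsIndContained H

/-- A partial `k`-tree is a spanning subgraph of a chordal graph with clique number `k + 1`. -/
def IsPartialKTree {V : Type*} (k : ℕ) (G : SimpleGraph V) : Prop :=
  ∃ H : SimpleGraph V, G ≤ H ∧ IsChordal H ∧ H.cliqueNum = k + 1

/-- A partial colouring of the vertices with `n` colours; `none` means uncoloured. -/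
abbrev PartialColoring (V : Type*) (n : ℕ) : Type _ := V → Option (Fin n)

/-- There is no monochromatic `(k + 1)`-clique: every colour class induces a subgraph all of
whose cliques have at most `k` vertices. -/
def IsCliqueRelaxed {V : Type*} (G : SimpleGraph V) (k : ℕ) {n : ℕ}
    (φ : PartialColoring V n) : Prop :=
  ∀ α : Fin n, (G.induce {v | φ v = some α}).CliqueFree (k + 1)

/-- A legal move from `φ` to `ψ`: one uncoloured vertex receives a colour, all other vertices are
left alone, and the result has no monochromatic `(k + 1)`-clique. -/
def IsLegalMove {V : Type*} (G : SimpleGraph V) (k : ℕ) {n : ℕ}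
    (φ ψ : PartialColoring V n) : Prop :=
  ∃ v : V, φ v = none ∧ (∃ α : Fin n, ψ v = some α) ∧ (∀ w : V, w ≠ v → ψ w = φ w) ∧
    IsCliqueRelaxed G k ψ

inductive Player : Type
  | alice
  | bob

/-- `AliceWinsFrom G k p φ`: Alice can force a win of the `k`-clique-relaxed colouring game on `G`
from the position `φ` with player `p` to move. A player with a legal move has to make one. The
game ends when every vertex is coloured (Alice wins) or when the player to move has no legal move
although some vertex is uncoloured (Bob wins). -/
inductive AliceWinsFrom {V : Type*} (G : SimpleGraph V) (k : ℕ) {n : ℕ} :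
    Player → PartialColoring V n → Prop
  | finished (p : Player) (φ : PartialColoring V n) (h : ∀ v : V, φ v ≠ none) :
      AliceWinsFrom G k p φ
  | aliceMove (φ ψ : PartialColoring V n) (hmove : IsLegalMove G k φ ψ)
      (hwin : AliceWinsFrom G k Player.bob ψ) : AliceWinsFrom G k Player.alice φ
  | bobMove (φ : PartialColoring V n) (hex : ∃ ψ : PartialColoring V n, IsLegalMove G k φ ψ)
      (hwin : ∀ ψ : PartialColoring V n, IsLegalMove G k φ ψ →
        AliceWinsFrom G k Player.alice ψ) : AliceWinsFrom G k Player.bob φ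

/-- Alice, who moves first on the uncoloured graph, has a winning strategy with `n` colours. -/
def AliceWins {V : Type*} (G : SimpleGraph V) (k n : ℕ) : Prop :=
  AliceWinsFrom G k Player.alice (fun _ => none : PartialColoring V n)

/-- The `k`-clique-relaxed game chromatic number: the least number of colours with which Alice has
a winning strategy (`⊤` if there is none). -/
noncomputable def gameChromaticNumber {V : Type*} (G : SimpleGraph V) (k : ℕ) : ℕ∞ :=
  ⨅ (n : ℕ) (_ : AliceWins G k n), (n : ℕ∞)

end CliqueRelaxedGame

/-! A chordal supergraph has an order in which the earlier neighbours `N v` of each vertex form a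
clique, of size at most `k`. Joining each vertex to its last earlier neighbour gives a rooted forest
in which `N v` consists of ancestors of `v`. Every `(k + 1)`-clique of the game graph is `K u` for
its last vertex `u`, so only such sets must be kept from being monochromatic, and each contains the
forest edge from `u` to its parent.

After each of her moves Alice ensures `Safe`: every uncoloured component of the forest has at most
one coloured vertex hanging below it, and every relevant `K u` whose forest edge has both ends
coloured shows two colours. An uncoloured vertex then has at most two coloured forest neighbours, a
parent and a child. Hence Bob is never stuck, and with four colours Alice can avoid both of these
colours as well as the colour Bob just used. If Bob breaks separation, she colours the vertex where
two upward paths meet; otherwise she colours a vertex common to all the sets he spoiled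
(`Safe.exists_reply`). -/

namespace CliqueRelaxedGame

/-! ### Perfect elimination orders of chordal graphs (Dirac). -/

section Chordal

variable {V : Type*}

/-- The edges of `G` with both ends in `U`, as a graph on all vertices. -/
def restrict (G : SimpleGraph V) (U : Set V) : SimpleGraph V where
  Adj a b := G.Adj a b ∧ a ∈ U ∧ b ∈ U
  symm := ⟨fun _ _ h => ⟨h.1.symm, h.2.2, h.2.1⟩⟩
  loopless := ⟨fun _ h => h.1.ne rfl⟩

theorem dist_getVert_of_length_eq_dist {G : SimpleGraph V} {a b : V} (p : G.Walk a b)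
    (hp : p.length = G.dist a b) {i : ℕ} (hi : i ≤ p.length) : G.dist a (p.getVert i) = i := by
  have h1 : G.dist a (p.getVert i) ≤ i :=
    (SimpleGraph.dist_le (p.take i)).trans (by simp)
  have h2 : G.dist (p.getVert i) b ≤ p.length - i :=
    (SimpleGraph.dist_le (p.drop i)).trans (by simp)
  have h3 := (p.take i).reachable.dist_triangle_left b
  omega

theorem cycleGraph_adj_last {n : ℕ} {i j : Fin (n + 2)} (hi : i.val ≤ n) (hj : j.val = n + 1) :
    (SimpleGraph.cycleGraph (n + 2)).Adj i j ↔ i.val = 0 ∨ i.val = n := by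
  rw [SimpleGraph.cycleGraph_adj', Fin.val_sub, Fin.val_sub, hj]
  rcases Nat.eq_zero_or_pos i.val with h0 | h0
  · rw [h0]
    have : n + 2 - 0 + (n + 1) = (n + 1) + (n + 2) := by omega
    rw [this, Nat.add_mod_right, Nat.mod_eq_of_lt (by omega), Nat.mod_eq_of_lt (by omega)]
    omega
  · have : n + 2 - i.val + (n + 1) = (n + 1 - i.val) + (n + 2) := by omega
    rw [this, Nat.add_mod_right, Nat.mod_eq_of_lt (by omega), Nat.mod_eq_of_lt (by omega)]
    omega

theorem cycleGraph_adj_of_lt {n : ℕ} {i j : Fin (n + 2)} (hij : i.val < j.val) (hj : j.val ≤ n) :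
    (SimpleGraph.cycleGraph (n + 2)).Adj i j ↔ j.val = i.val + 1 := by
  rw [SimpleGraph.cycleGraph_adj', Fin.val_sub, Fin.val_sub]
  have : n + 2 - i.val + j.val = (j.val - i.val) + (n + 2) := by omega
  rw [this, Nat.add_mod_right, Nat.mod_eq_of_lt (by omega), Nat.mod_eq_of_lt (by omega)]
  omega

/-- In a chordal graph, two neighbours of `x` joined by a path through non-neighbours of `x`
are adjacent. -/
theorem IsChordal.adj_of_reachable {G : SimpleGraph V} (hG : IsChordal G) {x a b : V} {C : Set V}
    (hab : a ≠ b) (hxa : G.Adj x a) (hxb : G.Adj x b) (hC : ∀ c ∈ C, c ≠ x ∧ ¬ G.Adj x c)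
    (hr : (restrict G (insert a (insert b C))).Reachable a b) : G.Adj a b := by
  by_contra hnab
  set U : Set V := insert a (insert b C) with hU
  -- A shortest path has no chords, so closing it up through `x` gives an induced cycle.
  obtain ⟨p, hp⟩ := hr.exists_walk_length_eq_dist
  set n := p.length with hn
  set P : ℕ → V := p.getVert with hP
  have hd : ∀ i ≤ n, (restrict G U).dist a (P i) = i := fun i hi =>
    dist_getVert_of_length_eq_dist p hp hi
  have hP0 : P 0 = a := p.getVert_zero
  have hPn : P n = b := p.getVert_length
  have hinj : ∀ i ≤ n, ∀ j ≤ n, P i = P j → i = j := fun i hi j hj h => by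
    rw [← hd i hi, h, hd j hj]
  have hsucc : ∀ i < n, (restrict G U).Adj (P i) (P (i + 1)) := fun i hi =>
    p.adj_getVert_succ hi
  -- Excluding lengths 0 and 1 makes the cycle, on `n + 2` vertices, long enough to contradict
  -- chordality.
  have hn0 : n ≠ 0 := by
    intro h
    rw [h, hP0] at hPn
    exact hab hPn
  have hn1 : n ≠ 1 := by
    intro h
    have := hsucc 0 (by omega)
    rw [hP0, zero_add, ← h, hPn] at this
    exact hnab this.1
  have hmem : ∀ i ≤ n, P i ∈ U := by
    intro i hi
    rcases Nat.lt_or_ge i n with h | h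
    · exact (hsucc i h).2.1
    · have : i = n := by omega
      rw [this, hPn]
      simp [hU]
  have hmemC : ∀ i, 0 < i → i < n → P i ∈ C := by
    intro i h0 h1
    rcases hmem i h1.le with h | h | h
    · exact absurd (hinj i h1.le 0 (by omega) (h.trans hP0.symm)) (by omega)
    · exact absurd (hinj i h1.le n le_rfl (h.trans hPn.symm)) (by omega)
    · exact h
  have hadj : ∀ i ≤ n, ∀ j ≤ n, i < j → (G.Adj (P i) (P j) ↔ j = i + 1) := by
    intro i hi j hj hij
    constructor
    · intro h
      have h' : (restrict G U).Adj (P i) (P j) := ⟨h, hmem i hi, hmem j hj⟩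
      have h2 := (p.take i).reachable.dist_triangle_left (P j)
      have h3 := SimpleGraph.dist_eq_one_iff_adj.2 h'
      have h4 := hd i hi
      have h5 := hd j hj
      change _ ≤ (restrict G U).dist a (P i) + (restrict G U).dist (P i) (P j) at h2
      omega
    · rintro rfl
      exact (hsucc i (by omega)).1
  have hx : ∀ i ≤ n, (G.Adj (P i) x ↔ i = 0 ∨ i = n) := by
    intro i hi
    constructor
    · intro h
      by_contra! hne
      exact (hC _ (hmemC i (by omega) (by omega))).2 h.symm
    · rintro (rfl | rfl)
      · rw [hP0]; exact hxa.symm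
      · rw [hPn]; exact hxb.symm
  have hxne : ∀ i ≤ n, P i ≠ x := by
    intro i hi h
    by_cases hi0 : i = 0 ∨ i = n
    · exact ((hx i hi).2 hi0).ne h
    · push Not at hi0
      exact (hC _ (hmemC i (by omega) (by omega))).1 h
  let f : Fin (n + 2) → V := fun i => if i.val ≤ n then P i else x
  have hf : ∀ i : Fin (n + 2), i.val ≤ n → f i = P i := fun i hi => if_pos hi
  have hf' : ∀ i : Fin (n + 2), i.val = n + 1 → f i = x := fun i hi => if_neg (by omega)
  have hfadj : ∀ i j : Fin (n + 2), i.val < j.val →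
      (G.Adj (f i) (f j) ↔ (SimpleGraph.cycleGraph (n + 2)).Adj i j) := by
    intro i j hij
    have hi : i.val ≤ n := by omega
    rcases Nat.lt_or_ge n j.val with hj | hj
    · have hj : j.val = n + 1 := by omega
      rw [hf i hi, hf' j hj, hx _ hi, cycleGraph_adj_last hi hj]
    · rw [hf i hi, hf j hj, hadj _ hi _ hj hij, cycleGraph_adj_of_lt hij hj]
  have hfne : ∀ i j : Fin (n + 2), i.val < j.val → f i ≠ f j := by
    intro i j hij h
    have hi : i.val ≤ n := by omega
    rcases Nat.lt_or_ge n j.val with hj | hj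
    · rw [hf i hi, hf' j (by omega)] at h
      exact hxne _ hi h
    · rw [hf i hi, hf j hj] at h
      have := hinj _ hi _ hj h
      omega
  refine hG (n + 2) (by omega) ⟨⟨⟨f, ?_⟩, ?_⟩⟩
  · intro i j h
    rcases lt_trichotomy i.val j.val with hlt | heq | hgt
    · exact absurd h (hfne i j hlt)
    · exact Fin.ext heq
    · exact absurd h.symm (hfne j i hgt)
  · intro i j
    change G.Adj (f i) (f j) ↔ _
    rcases lt_trichotomy i.val j.val with hlt | heq | hgt
    · exact hfadj i j hlt
    · rw [Fin.ext heq]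
      exact iff_of_false (G.irrefl) (SimpleGraph.irrefl _)
    · rw [G.adj_comm, (SimpleGraph.cycleGraph (n + 2)).adj_comm]
      exact hfadj j i hgt

/-- The neighbours of `y` in `A` are pairwise adjacent. -/
def IsSimplicialIn (G : SimpleGraph V) (A : Finset V) (y : V) : Prop :=
  ∀ u ∈ A, ∀ w ∈ A, G.Adj y u → G.Adj y w → u ≠ w → G.Adj u w

/-- Let `C` be a component of the non-neighbours of `x` and `S` the neighbours of `x` attached to
`C`. Chordality makes `S` a clique, and `C ∪ S` contains every neighbour in `A` of a vertex of `C`.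
A vertex of `C` simplicial in the smaller set `C ∪ S` is therefore simplicial in `A`. -/
theorem IsChordal.exists_isSimplicialIn_not_adj {G : SimpleGraph V} (hG : IsChordal G)
    (A : Finset V) : ∀ x ∈ A, (∃ y ∈ A, y ≠ x ∧ ¬ G.Adj x y) →
      ∃ y ∈ A, y ≠ x ∧ ¬ G.Adj x y ∧ IsSimplicialIn G A y := by
  classical
  induction A using Finset.strongInduction with
  | H A ih =>
  rintro x hx ⟨y₀, hy₀A, hy₀x, hy₀⟩
  let D : Set V := {y | y ∈ A ∧ y ≠ x ∧ ¬ G.Adj x y}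
  let C : Finset V := A.filter fun c => c ∈ D ∧ (restrict G D).Reachable y₀ c
  let S : Finset V := A.filter fun s => G.Adj x s ∧ ∃ c ∈ C, G.Adj s c
  have hC : ∀ c, c ∈ C ↔ c ∈ D ∧ (restrict G D).Reachable y₀ c := fun c => by
    simp only [C, Finset.mem_filter, and_iff_right_iff_imp]
    exact fun h => h.1.1
  have hS : ∀ s, s ∈ S ↔ s ∈ A ∧ G.Adj x s ∧ ∃ c ∈ C, G.Adj s c := fun s => by
    simp only [S, Finset.mem_filter]
  have hy₀C : y₀ ∈ C := (hC _).2 ⟨⟨hy₀A, hy₀x, hy₀⟩, SimpleGraph.Reachable.refl _⟩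
  have hnbr : ∀ c ∈ C, ∀ u ∈ A, G.Adj c u → u ∈ C ∪ S := by
    intro c hc u hu hcu
    rw [Finset.mem_union]
    by_cases hxu : G.Adj x u
    · exact Or.inr ((hS u).2 ⟨hu, hxu, c, hc, hcu.symm⟩)
    · obtain ⟨hcD, hcr⟩ := (hC c).1 hc
      have hux : u ≠ x := by
        rintro rfl
        exact hcD.2.2 hcu.symm
      have huD : u ∈ D := ⟨hu, hux, hxu⟩
      have hadj : (restrict G D).Adj c u := ⟨hcu, hcD, huD⟩
      exact Or.inl ((hC u).2 ⟨huD, hcr.trans hadj.reachable⟩)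
  have hclique : ∀ a ∈ S, ∀ b ∈ S, a ≠ b → G.Adj a b := by
    intro a ha b hb hab
    obtain ⟨-, hxa, c, hc, hac⟩ := (hS a).1 ha
    obtain ⟨-, hxb, d, hd, hbd⟩ := (hS b).1 hb
    obtain ⟨hcD, hcr⟩ := (hC c).1 hc
    obtain ⟨hdD, hdr⟩ := (hC d).1 hd
    refine hG.adj_of_reachable (C := D) hab hxa hxb (fun c hc => hc.2) ?_
    have h1 : (restrict G (insert a (insert b D))).Adj a c := ⟨hac, by simp, by simp [hcD]⟩
    have h2 : (restrict G (insert a (insert b D))).Adj d b := ⟨hbd.symm, by simp [hdD], by simp⟩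
    have hle : restrict G D ≤ restrict G (insert a (insert b D)) := fun u w h =>
      ⟨h.1, by simp [h.2.1], by simp [h.2.2]⟩
    exact h1.reachable.trans (((hcr.symm.trans hdr).mono hle).trans h2.reachable)
  have hlt : C ∪ S ⊂ A := by
    refine Finset.ssubset_iff_of_subset ?_ |>.2 ⟨x, hx, ?_⟩
    · exact Finset.union_subset (Finset.filter_subset _ _) (Finset.filter_subset _ _)
    · rw [Finset.mem_union]
      rintro (h | h)
      · exact ((hC x).1 h).1.2.1 rfl
      · exact ((hS x).1 h).2.1.ne rfl
  suffices h : ∃ y ∈ C, IsSimplicialIn G (C ∪ S) y by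
    obtain ⟨y, hyC, hy⟩ := h
    have hyD := ((hC y).1 hyC).1
    exact ⟨y, hyD.1, hyD.2.1, hyD.2.2, fun u hu w hw hyu hyw =>
      hy u (hnbr y hyC u hu hyu) w (hnbr y hyC w hw hyw) hyu hyw⟩
  -- Induction is applied to a vertex that is not joined to all of `C ∪ S`, taken in `S` if
  -- possible: the simplicial vertex obtained misses it, and so cannot lie in `S`. If no such vertex
  -- exists, `C ∪ S` is a clique.
  by_cases h1 : ∃ s ∈ S, ∃ t ∈ C ∪ S, t ≠ s ∧ ¬ G.Adj s t
  · obtain ⟨s, hs, ht⟩ := h1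
    obtain ⟨y, hy, hys, hsy, hsimp⟩ := ih _ hlt s (Finset.mem_union_right _ hs) ht
    rcases Finset.mem_union.1 hy with hyC | hyS
    · exact ⟨y, hyC, hsimp⟩
    · exact absurd (hclique s hs y hyS hys.symm) hsy
  push Not at h1
  by_cases h2 : ∃ c ∈ C, ∃ t ∈ C ∪ S, t ≠ c ∧ ¬ G.Adj c t
  · obtain ⟨c, hc, ht⟩ := h2
    obtain ⟨y, hy, hyc, hcy, hsimp⟩ := ih _ hlt c (Finset.mem_union_left _ hc) ht
    rcases Finset.mem_union.1 hy with hyC | hyS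
    · exact ⟨y, hyC, hsimp⟩
    · exact absurd (h1 y hyS c (Finset.mem_union_left _ hc) hyc.symm).symm hcy
  push Not at h2
  refine ⟨y₀, hy₀C, fun u hu w hw _ _ huw => ?_⟩
  rcases Finset.mem_union.1 hu with h | h
  · exact h2 u h w hw huw.symm
  · exact h1 u h w hw huw.symm

theorem IsChordal.exists_isSimplicialIn {G : SimpleGraph V} (hG : IsChordal G)
    {A : Finset V} (hA : A.Nonempty) : ∃ y ∈ A, IsSimplicialIn G A y := by
  by_cases h : ∃ x ∈ A, ∃ y ∈ A, y ≠ x ∧ ¬ G.Adj x y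
  · obtain ⟨x, hx, h⟩ := h
    obtain ⟨y, hy, -, -, hs⟩ := hG.exists_isSimplicialIn_not_adj A x hx h
    exact ⟨y, hy, hs⟩
  · push Not at h
    obtain ⟨y, hy⟩ := hA
    exact ⟨y, hy, fun u hu w hw _ _ huw => h u hu w hw huw.symm⟩

theorem IsChordal.exists_elimination_order_on {G : SimpleGraph V} (hG : IsChordal G)
    (A : Finset V) : ∃ ord : V → ℕ, (∀ v ∈ A, ord v < A.card) ∧ Set.InjOn ord A ∧
      ∀ v ∈ A, IsSimplicialIn G (A.filter fun u => ord u < ord v) v := by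
  classical
  induction A using Finset.strongInduction with
  | H A ih =>
  rcases A.eq_empty_or_nonempty with rfl | hA
  · exact ⟨fun _ => 0, by simp, by simp, by simp⟩
  obtain ⟨y, hy, hys⟩ := hG.exists_isSimplicialIn hA
  obtain ⟨ord, hlt, hinj, hord⟩ := ih _ (Finset.erase_ssubset hy)
  have hcard : (A.erase y).card + 1 = A.card := Finset.card_erase_add_one hy
  -- The simplicial vertex `y` is placed last, so it is never an earlier neighbour of another vertex
  -- of `A`.
  refine ⟨Function.update ord y (A.erase y).card, ?_, ?_, ?_⟩
  · intro v hv
    by_cases h : v = y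
    · subst h; simp only [Function.update_self]; omega
    · rw [Function.update_of_ne h]
      have := hlt v (Finset.mem_erase.2 ⟨h, hv⟩)
      omega
  · intro v hv w hw h
    by_cases hvy : v = y <;> by_cases hwy : w = y
    · rw [hvy, hwy]
    · subst hvy
      rw [Function.update_self, Function.update_of_ne hwy] at h
      have := hlt w (Finset.mem_erase.2 ⟨hwy, hw⟩)
      omega
    · subst hwy
      rw [Function.update_self, Function.update_of_ne hvy] at h
      have := hlt v (Finset.mem_erase.2 ⟨hvy, hv⟩)
      omega
    · rw [Function.update_of_ne hvy, Function.update_of_ne hwy] at h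
      exact hinj (by simpa [hvy] using hv) (by simpa [hwy] using hw) h
  · intro v hv u hu w hw
    by_cases hvy : v = y
    · subst hvy
      exact hys u (Finset.mem_of_mem_filter u hu) w (Finset.mem_of_mem_filter w hw)
    · have hlow : ∀ z ∈ A.filter (fun u => Function.update ord y (A.erase y).card u <
          Function.update ord y (A.erase y).card v),
          z ∈ (A.erase y).filter fun u => ord u < ord v := by
        intro z hz
        rw [Finset.mem_filter, Function.update_of_ne hvy] at hz
        have hv' := hlt v (Finset.mem_erase.2 ⟨hvy, hv⟩)
        by_cases hzy : z = y
        · subst hzy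
          rw [Function.update_self] at hz
          omega
        · rw [Function.update_of_ne hzy] at hz
          exact Finset.mem_filter.2 ⟨Finset.mem_erase.2 ⟨hzy, hz.1⟩, hz.2⟩
      exact hord v (Finset.mem_erase.2 ⟨hvy, hv⟩) u (hlow u hu) w (hlow w hw)

end Chordal

/-! ### The parent forest of an elimination order, and separation. -/

section Forest

variable {V : Type*}

/-- An elimination order on `V`: `N v` is the set of earlier neighbours of `v`, and any two
earlier neighbours of `v` are neighbours of each other. -/
structure EliminationOrder (V : Type*) where
  ord : V → ℕ
  N : V → Finset V
  ord_lt : ∀ v, ∀ x ∈ N v, ord x < ord v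
  ord_inj : Function.Injective ord
  mem_N : ∀ v, ∀ x ∈ N v, ∀ y ∈ N v, ord x < ord y → x ∈ N y

namespace EliminationOrder

variable (O : EliminationOrder V)

/-- `y` is the parent of `v`: the last among the earlier neighbours of `v`. -/
def Par (v y : V) : Prop := y ∈ O.N v ∧ ∀ z ∈ O.N v, O.ord z ≤ O.ord y

/-- The parent relation restricted to parents outside `S`. -/
def ParOutside (S : Set V) (v y : V) : Prop := O.Par v y ∧ y ∉ S

/-- Every component of the forest outside `S` has at most one element of `S` hanging below it. -/
def Separated (S : Set V) : Prop :=
  ∀ w ∈ S, ∀ w' ∈ S, ∀ t, Relation.TransGen (O.ParOutside S) w t →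
    Relation.TransGen (O.ParOutside S) w' t → w = w'

variable {O}

theorem Par.unique {v y z : V} (h : O.Par v y) (h' : O.Par v z) : y = z :=
  O.ord_inj (le_antisymm (h'.2 _ h.1) (h.2 _ h'.1))

theorem Par.lt {v y : V} (h : O.Par v y) : O.ord y < O.ord v := O.ord_lt _ _ h.1

theorem Par.mem_N {v y x : V} (h : O.Par v y) (hx : x ∈ O.N v) (hxy : x ≠ y) : x ∈ O.N y :=
  O.mem_N v x hx y h.1 ((h.2 x hx).lt_of_ne fun e => hxy (O.ord_inj e))

theorem exists_par {v x : V} (hx : x ∈ O.N v) : ∃ y, O.Par v y := by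
  obtain ⟨y, hy, h⟩ := Finset.exists_max_image (O.N v) O.ord ⟨x, hx⟩
  exact ⟨y, hy, h⟩

theorem transGen_par_lt {v y : V} (h : Relation.TransGen O.Par v y) : O.ord y < O.ord v := by
  induction h with
  | single h => exact h.lt
  | tail _ h ih => exact h.lt.trans ih

/-- Apart from the parent itself, earlier neighbours of `v` are earlier neighbours of its parent, so
induction climbs the forest. -/
theorem transGen_par_of_mem_N (v : V) : ∀ x ∈ O.N v, Relation.TransGen O.Par v x := by
  induction hn : O.ord v using Nat.strong_induction_on generalizing v with
  | _ n ih =>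
  intro x hx
  obtain ⟨y, hy⟩ := exists_par hx
  by_cases hxy : x = y
  · exact hxy ▸ .single hy
  · exact .head hy (ih _ (hn ▸ hy.lt) y rfl x (hy.mem_N hx hxy))

theorem transGen_par {S : Set V} {v y : V} (h : Relation.TransGen (O.ParOutside S) v y) :
    Relation.TransGen O.Par v y :=
  Relation.TransGen.mono (fun _ _ h => h.1) _ _ h

theorem transGen_anti {S T : Set V} (hST : S ⊆ T) {v y : V}
    (h : Relation.TransGen (O.ParOutside T) v y) : Relation.TransGen (O.ParOutside S) v y :=
  Relation.TransGen.mono (fun _ _ h => ⟨h.1, fun hS => h.2 (hST hS)⟩) _ _ h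

theorem notMem_of_transGen {S : Set V} {v y : V} (h : Relation.TransGen (O.ParOutside S) v y) :
    y ∉ S := by
  cases h with
  | single h => exact h.2
  | tail _ h => exact h.2

/-- Parents are unique, so there is only one upward path from `w` to `t`, and `v` lies on it. -/
theorem notMem_of_between {S : Set V} {w v t : V} (h : Relation.TransGen (O.ParOutside S) w t)
    (hwv : Relation.TransGen O.Par w v) (hvt : Relation.ReflTransGen O.Par v t) : v ∉ S := by
  have hvt' : O.ord t ≤ O.ord v := by
    rcases Relation.reflTransGen_iff_eq_or_transGen.1 hvt with h | h
    · rw [h]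
    · exact (transGen_par_lt h).le
  induction h using Relation.TransGen.head_induction_on with
  | @single a h =>
    obtain ⟨b, hab, hbv⟩ := Relation.TransGen.head'_iff.1 hwv
    obtain rfl := h.1.unique hab
    rcases Relation.reflTransGen_iff_eq_or_transGen.1 hbv with rfl | h'
    · exact h.2
    · exact absurd (transGen_par_lt h') hvt'.not_gt
  | @head a b h _ ih =>
    obtain ⟨c, hac, hcv⟩ := Relation.TransGen.head'_iff.1 hwv
    obtain rfl := h.1.unique hac
    rcases Relation.reflTransGen_iff_eq_or_transGen.1 hcv with rfl | h'
    · exact h.2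
    · exact ih h'

/-- No path outside the set leaves `v` upwards, so `v` hangs below no component. -/
theorem Separated.insert_of_par_mem {S : Set V} (hS : O.Separated S) {v : V}
    (hv : ∀ y, O.Par v y → y ∈ S) : O.Separated (insert v S) := by
  have key : ∀ w ∈ insert v S, ∀ t, Relation.TransGen (O.ParOutside (insert v S)) w t →
      w ∈ S := by
    rintro w (rfl | hw) t ht
    · obtain ⟨y, hy, -⟩ := Relation.TransGen.head'_iff.1 ht
      exact absurd (Set.mem_insert_of_mem _ (hv y hy.1)) hy.2
    · exact hw
  intro w hw w' hw' t ht ht'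
  exact hS w (key w hw t ht) w' (key w' hw' t ht') t (transGen_anti (Set.subset_insert _ _) ht)
    (transGen_anti (Set.subset_insert _ _) ht')

theorem exists_last_mem {S : Set V} {u v : V} (hu : u ∈ S) (h : Relation.TransGen O.Par u v)
    (hv : v ∉ S) : ∃ x ∈ S, Relation.TransGen (O.ParOutside S) x v := by
  induction h with
  | single h => exact ⟨u, hu, .single ⟨h, hv⟩⟩
  | @tail b c _ hbc ih =>
    by_cases hb : b ∈ S
    · exact ⟨b, hb, .single ⟨hbc, hv⟩⟩
    · obtain ⟨x, hx, hxb⟩ := ih hb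
      exact ⟨x, hx, hxb.tail ⟨hbc, hv⟩⟩

/-- The only element of `S` below the component of `v` already reaches `v`. Once `v` is inserted, it
replaces that element below the part of the component above `v`. -/
theorem Separated.insert_of_transGen {S : Set V} (hS : O.Separated S) {u v : V} (hu : u ∈ S)
    (hv : v ∉ S) (huv : Relation.TransGen O.Par u v) : O.Separated (insert v S) := by
  obtain ⟨x, hx, hxv⟩ := exists_last_mem hu huv hv
  have key : ∀ w ∈ S, ∀ t, Relation.TransGen (O.ParOutside (insert v S)) w t →
      ¬ Relation.TransGen (O.ParOutside (insert v S)) v t := by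
    intro w hw t hwt hvt
    have hwt' := transGen_anti (Set.subset_insert _ _) hwt
    have hvt' := transGen_anti (Set.subset_insert _ _) hvt
    obtain rfl := hS x hx w hw t (hxv.trans hvt') hwt'
    exact notMem_of_between hwt (transGen_par hxv) (transGen_par hvt).to_reflTransGen
      (Set.mem_insert _ _)
  rintro w (rfl | hw) w' (rfl | hw') t ht ht'
  · rfl
  · exact absurd ht (key w' hw' t ht')
  · exact absurd ht' (key w hw t ht)
  · exact hS w hw w' hw' t (transGen_anti (Set.subset_insert _ _) ht)
      (transGen_anti (Set.subset_insert _ _) ht')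

theorem Separated.exists_insert_insert [Finite V] {S : Set V} (hS : O.Separated S) {u : V}
    (hu : u ∉ S) (hSu : ¬ O.Separated (insert u S)) :
    ∃ m ∉ insert u S, O.Separated (insert m (insert u S)) := by
  set T := insert u S with hT
  have hST : S ⊆ T := Set.subset_insert _ _
  let M : Set V := {t | Relation.TransGen (O.ParOutside T) u t ∧
    ∃ s ∈ S, Relation.TransGen (O.ParOutside T) s t}
  have hM : M.Nonempty := by
    by_contra hM
    refine hSu ?_
    rintro w (rfl | hw) w' (rfl | hw') t ht ht'
    · rfl
    · exact absurd ⟨t, ht, w', hw', ht'⟩ hM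
    · exact absurd ⟨t, ht', w, hw, ht⟩ hM
    · exact hS w hw w' hw' t (transGen_anti hST ht) (transGen_anti hST ht')
  -- Since ancestors come earlier in the order, the latest common vertex `m` is where the upward
  -- paths from `u` and `s` first meet.
  obtain ⟨m, ⟨hum, s, hs, hsm⟩, hmax⟩ := Set.exists_max_image M O.ord (Set.toFinite M) hM
  refine ⟨m, notMem_of_transGen hum, ?_⟩
  have hTm : T ⊆ insert m T := Set.subset_insert _ _
  have key1 : ∀ w ∈ T, ∀ t, Relation.TransGen (O.ParOutside (insert m T)) w t →
      ¬ Relation.TransGen (O.ParOutside (insert m T)) m t := by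
    intro w hw t hwt hmt
    have hwm : Relation.TransGen O.Par w m := by
      rcases hw with rfl | hw
      · exact transGen_par hum
      · have hst := hsm.trans (transGen_anti hTm hmt)
        obtain rfl := hS s hs w hw t (transGen_anti hST hst)
          (transGen_anti (hST.trans hTm) hwt)
        exact transGen_par hsm
    exact notMem_of_between hwt hwm (transGen_par hmt).to_reflTransGen (Set.mem_insert _ _)
  have key2 : ∀ w ∈ S, ∀ t, Relation.TransGen (O.ParOutside (insert m T)) u t →
      ¬ Relation.TransGen (O.ParOutside (insert m T)) w t := by
    intro w hw t hut hwt
    have htM : t ∈ M := ⟨transGen_anti hTm hut, w, hw, transGen_anti hTm hwt⟩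
    rcases Relation.ReflTransGen.total_of_right_unique (r := O.Par)
      (fun _ _ _ h h' => h.unique h') (transGen_par hum).to_reflTransGen
      (transGen_par hut).to_reflTransGen with h | h
    · exact notMem_of_between hut (transGen_par hum) h (Set.mem_insert _ _)
    · rcases Relation.reflTransGen_iff_eq_or_transGen.1 h with h | h
      · exact notMem_of_transGen hut (h ▸ Set.mem_insert _ _)
      · exact (hmax t htM).not_gt (transGen_par_lt h)
  rintro w (rfl | hw) w' (rfl | hw') t ht ht'
  · rfl
  · exact absurd ht (key1 w' hw' t ht')
  · exact absurd ht' (key1 w hw t ht)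
  · rcases hw with rfl | hw <;> rcases hw' with rfl | hw'
    · rfl
    · exact absurd ht' (key2 w' hw' t ht)
    · exact absurd ht (key2 w hw t ht')
    · exact hS w hw w' hw' t (transGen_anti (hST.trans hTm) ht)
        (transGen_anti (hST.trans hTm) ht')

end EliminationOrder

end Forest

/-! ### Alice's invariant and her reply to a move of Bob. -/

section Strategy

variable {V : Type*}

namespace EliminationOrder

variable (O : EliminationOrder V)

/-- The set consisting of `u` and its earlier neighbours. -/
def K (u : V) : Set V := insert u {x | x ∈ O.N u}

/-- None of the sets `O.K u` with `u ∈ E` is monochromatic. -/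
def NoMono (E : Set V) {n : ℕ} (φ : PartialColoring V n) : Prop :=
  ∀ u ∈ E, ∀ α, ∃ x ∈ O.K u, φ x ≠ some α

/-- Two colours occur on `O.K u`. -/
def Bichromatic {n : ℕ} (φ : PartialColoring V n) (u : V) : Prop :=
  ∃ x ∈ O.K u, ∃ y ∈ O.K u, ∃ α β, φ x = some α ∧ φ y = some β ∧ α ≠ β

/-- Every set `O.K u` with `u ∈ E` sees two colours as soon as `u` and its parent are coloured. -/
def EdgesBichromatic (E : Set V) {n : ℕ} (φ : PartialColoring V n) : Prop :=
  ∀ u ∈ E, ∀ y, O.Par u y → φ u ≠ none → φ y ≠ none → O.Bichromatic φ u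

/-- The invariant that Alice maintains. -/
structure Safe (E : Set V) {n : ℕ} (φ : PartialColoring V n) : Prop where
  separated : O.Separated {v | φ v ≠ none}
  edges : O.EdgesBichromatic E φ

variable {O} {E : Set V} {n : ℕ} {φ : PartialColoring V n}

theorem mem_K_self (u : V) : u ∈ O.K u := Set.mem_insert _ _

theorem Par.mem_K {u y : V} (h : O.Par u y) : y ∈ O.K u := Set.mem_insert_of_mem _ h.1

theorem Bichromatic.not_mono {u : V} (h : O.Bichromatic φ u) (α : Fin n) :
    ∃ x ∈ O.K u, φ x ≠ some α := by
  obtain ⟨x, hx, y, hy, β, γ, hβ, hγ, hne⟩ := h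
  by_contra! hc
  rw [hc x hx, Option.some_inj] at hβ
  rw [hc y hy, Option.some_inj] at hγ
  exact hne (hβ.symm.trans hγ)

theorem Safe.exists_color_outside {φ : PartialColoring V 4} (h : O.Safe E φ) {v : V}
    (hv : φ v = none) (β : Fin 4) :
    ∃ γ, γ ≠ β ∧ (∀ y, O.Par v y → φ y ≠ some γ) ∧ ∀ c, O.Par c v → φ c ≠ some γ := by
  have h1 : ∃ a : Fin 4, ∀ y, O.Par v y → ∀ γ, φ y = some γ → γ = a := by
    by_cases hy : ∃ y, O.Par v y ∧ ∃ a, φ y = some a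
    · obtain ⟨y, hy, a, ha⟩ := hy
      refine ⟨a, fun z hz γ hγ => ?_⟩
      rw [hz.unique hy, ha] at hγ
      exact (Option.some_inj.1 hγ).symm
    -- There is no parent colour to avoid, so an arbitrary colour is forbidden.
    · exact ⟨0, fun y hvy γ hγ => absurd ⟨y, hvy, γ, hγ⟩ hy⟩
  have h2 : ∃ a : Fin 4, ∀ c, O.Par c v → ∀ γ, φ c = some γ → γ = a := by
    by_cases hc : ∃ c, O.Par c v ∧ ∃ a, φ c = some a
    · obtain ⟨c, hc, a, ha⟩ := hc
      refine ⟨a, fun d hd γ hγ => ?_⟩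
      have hvS : v ∉ {v | φ v ≠ none} := fun h => h hv
      have hdc : d = c := h.separated d (by simp [hγ]) c (by simp [ha]) v
        (.single ⟨hd, hvS⟩) (.single ⟨hc, hvS⟩)
      rw [hdc, ha] at hγ
      exact (Option.some_inj.1 hγ).symm
    · exact ⟨0, fun c hcv γ hγ => absurd ⟨c, hcv, γ, hγ⟩ hc⟩
  obtain ⟨a, ha⟩ := h1
  obtain ⟨b, hb⟩ := h2
  -- This is where four colours are needed: parent, child and `β` forbid at most three.
  have h3 : ∀ a b β : Fin 4, ∃ γ, γ ≠ β ∧ γ ≠ a ∧ γ ≠ b := by decide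
  obtain ⟨γ, hγβ, hγa, hγb⟩ := h3 a b β
  exact ⟨γ, hγβ, fun y hy hγ => hγa (ha y hy γ hγ), fun c hc hγ => hγb (hb c hc γ hγ)⟩

theorem Safe.noMono (hE : ∀ u ∈ E, (O.N u).Nonempty) (h : O.Safe E φ) : O.NoMono E φ := by
  intro u hu α
  by_contra! hc
  obtain ⟨x, hx⟩ := hE u hu
  obtain ⟨y, hy⟩ := exists_par hx
  obtain ⟨z, hz, hne⟩ := (h.edges u hu y hy (by simp [hc u (mem_K_self u)])
    (by simp [hc y hy.mem_K])).not_mono α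
  exact hne (hc z hz)

/-- A newly monochromatic `K u` contains `v`. Either `v` is an end of its forest edge and the other
end has a different colour, or both ends were already coloured and two colours were present. -/
theorem Safe.noMono_update [DecidableEq V] (hE : ∀ u ∈ E, (O.N u).Nonempty)
    (h : O.Safe E φ) {v : V} (hv : φ v = none)
    {γ : Fin n} (hp : ∀ y, O.Par v y → φ y ≠ some γ) (hc : ∀ c, O.Par c v → φ c ≠ some γ) :
    O.NoMono E (Function.update φ v (some γ)) := by
  intro u hu α
  by_contra! hmono
  by_cases hvu : v ∈ O.K u
  · have hα : γ = α := by simpa using hmono v hvu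
    subst hα
    have hmono' : ∀ x ∈ O.K u, x ≠ v → φ x = some γ := fun x hx hxv => by
      simpa [hxv] using hmono x hx
    obtain ⟨x, hx⟩ := hE u hu
    obtain ⟨y, hy⟩ := exists_par hx
    by_cases huv : u = v
    · subst huv
      exact hp y hy (hmono' y hy.mem_K (fun e => (e ▸ hy.lt).ne rfl))
    by_cases hyv : y = v
    · subst hyv
      exact hc u hy (hmono' u (mem_K_self u) huv)
    obtain ⟨a, ha, b, hb, α, β, hα, hβ, hne⟩ := h.edges u hu y hy
      (by simp [hmono' u (mem_K_self u) huv]) (by simp [hmono' y hy.mem_K hyv])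
    rw [hmono' a ha (by rintro rfl; simp [hv] at hα), Option.some_inj] at hα
    rw [hmono' b hb (by rintro rfl; simp [hv] at hβ), Option.some_inj] at hβ
    exact hne (hα.symm.trans hβ)
  · obtain ⟨z, hz, hne⟩ := h.noMono hE u hu α
    refine hne ?_
    have := hmono z hz
    rwa [Function.update_of_ne (by rintro rfl; exact hvu hz)] at this

theorem Safe.exists_noMono_update [DecidableEq V] (hE : ∀ u ∈ E, (O.N u).Nonempty)
    {φ : PartialColoring V 4} (h : O.Safe E φ)
    {v : V} (hv : φ v = none) : ∃ γ, O.NoMono E (Function.update φ v (some γ)) := by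
  obtain ⟨γ, -, hp, hc⟩ := h.exists_color_outside hv 0
  exact ⟨γ, h.noMono_update hE hv hp hc⟩

theorem Bichromatic.update [DecidableEq V] {u v : V} (h : O.Bichromatic φ u) (hv : φ v = none)
    (γ : Option (Fin n)) : O.Bichromatic (Function.update φ v γ) u := by
  obtain ⟨a, ha, b, hb, α, β, hα, hβ, hne⟩ := h
  refine ⟨a, ha, b, hb, α, β, ?_, ?_, hne⟩
  · rwa [Function.update_of_ne (by rintro rfl; simp [hv] at hα)]
  · rwa [Function.update_of_ne (by rintro rfl; simp [hv] at hβ)]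

/-- Alice's reply at `v` to the move of Bob at `u` restores `EdgesBichromatic`, provided that `v`
lies in every set spoiled by Bob. -/
theorem Safe.exists_edgesBichromatic_update [DecidableEq V] {φ : PartialColoring V 4}
    (h : O.Safe E φ) {u v : V} {β : Fin 4} (hu : φ u = none)
    (hv : Function.update φ u (some β) v = none)
    (hd : ∀ x ∈ E, ∀ y, O.Par x y → x = u ∨ y = u → Function.update φ u (some β) x ≠ none →
      Function.update φ u (some β) y ≠ none →
      O.Bichromatic (Function.update φ u (some β)) x ∨ v ∈ O.K x) :
    ∃ γ, O.EdgesBichromatic E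
      (Function.update (Function.update φ u (some β)) v (some γ)) := by
  have hvu : v ≠ u := by
    rintro rfl
    simp at hv
  have hφv : φ v = none := by rwa [Function.update_of_ne hvu] at hv
  -- The invariant holds before Bob's move, so it bounds only the older coloured neighbours of `v`;
  -- his own vertex is handled by `γ ≠ β`.
  obtain ⟨γ, hγβ, hp, hc⟩ := h.exists_color_outside hφv β
  set φ₁ := Function.update φ u (some β) with hφ₁
  have hφ₁u : φ₁ u = some β := Function.update_self ..
  have hne : ∀ x, φ x ≠ some γ → φ₁ x ≠ some γ := by
    intro x hx
    by_cases hxu : x = u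
    · rw [hxu, hφ₁u]
      exact fun e => hγβ (Option.some_inj.1 e).symm
    · rwa [hφ₁, Function.update_of_ne hxu]
  refine ⟨γ, fun x hx y hxy hx' hy' => ?_⟩
  have hbi : ∀ z, z ∈ O.K x → v ∈ O.K x → z ≠ v → φ₁ z ≠ none → φ₁ z ≠ some γ →
      O.Bichromatic (Function.update φ₁ v (some γ)) x := by
    intro z hz hvx hzv hz1 hz2
    obtain ⟨δ, hδ⟩ := Option.ne_none_iff_exists'.1 hz1
    refine ⟨z, hz, v, hvx, δ, γ, ?_, Function.update_self .., ?_⟩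
    · rwa [Function.update_of_ne hzv]
    · rintro rfl
      exact hz2 hδ
  have hyx : y ≠ x := fun e => (e ▸ hxy.lt).ne rfl
  by_cases hxv : x = v
  · subst hxv
    rw [Function.update_of_ne hyx] at hy'
    exact hbi y hxy.mem_K (mem_K_self x) hyx hy' (hne y (hp y hxy))
  by_cases hyv : y = v
  · subst hyv
    rw [Function.update_of_ne hxv] at hx'
    exact hbi x (mem_K_self x) hxy.mem_K hxv hx' (hne x (hc x hxy))
  rw [Function.update_of_ne hxv] at hx'
  rw [Function.update_of_ne hyv] at hy'
  by_cases hxyu : x = u ∨ y = u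
  · rcases hd x hx y hxy hxyu hx' hy' with hb | hvx
    · exact hb.update hv _
    · have huK : u ∈ O.K x := by
        rcases hxyu with rfl | rfl
        · exact mem_K_self _
        · exact hxy.mem_K
      exact hbi u huK hvx hvu.symm (by simp [hφ₁u])
        (by rw [hφ₁u]; exact fun e => hγβ (Option.some_inj.1 e).symm)
  · push Not at hxyu
    rw [hφ₁, Function.update_of_ne hxyu.1] at hx'
    rw [hφ₁, Function.update_of_ne hxyu.2] at hy'
    exact ((h.edges x hx y hxy hx' hy').update hu _).update hv _

theorem setOf_update_ne_none [DecidableEq V] (φ : PartialColoring V n) (v : V) (γ : Fin n) :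
    {x | Function.update φ v (some γ) x ≠ none} = insert v {x | φ x ≠ none} := by
  ext x
  by_cases hx : x = v
  · subst hx; simp
  · simp [hx]

/-- A set with a coloured vertex that is neither monochromatic nor bichromatic has an uncoloured
vertex. -/
theorem NoMono.exists_eq_none (h : O.NoMono E φ) {x : V} (hx : x ∈ E) {u : V} (hu : u ∈ O.K x)
    {β : Fin n} (hβ : φ u = some β) (hb : ¬ O.Bichromatic φ x) : ∃ v ∈ O.K x, φ v = none := by
  obtain ⟨v, hv, hne⟩ := h x hx β
  refine ⟨v, hv, ?_⟩
  by_contra hnone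
  obtain ⟨δ, hδ⟩ := Option.ne_none_iff_exists'.1 hnone
  exact hb ⟨v, hv, u, hu, δ, β, hδ, hβ, fun e => hne (e ▸ hδ)⟩

/-- An uncoloured vertex all of whose earlier neighbours are coloured. -/
theorem exists_first_eq_none [Finite V] (hφ : ∃ v, φ v = none) :
    ∃ v, φ v = none ∧ ∀ y, O.Par v y → φ y ≠ none := by
  obtain ⟨v, hv, hmin⟩ := Set.exists_min_image {v | φ v = none} O.ord (Set.toFinite _) hφ
  exact ⟨v, hv, fun y hy hy' => (hmin y hy').not_gt hy.lt⟩

/-- Alice can restore the invariant after every legal move of Bob. -/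
theorem Safe.exists_reply [Finite V] [DecidableEq V] {φ : PartialColoring V 4} (h : O.Safe E φ)
    {u : V} {β : Fin 4} (hu : φ u = none) (hleg : O.NoMono E (Function.update φ u (some β)))
    (hex : ∃ v, Function.update φ u (some β) v = none) :
    ∃ v γ, Function.update φ u (some β) v = none ∧
      O.Safe E (Function.update (Function.update φ u (some β)) v (some γ)) := by
  suffices hs : ∃ v, Function.update φ u (some β) v = none ∧
      O.Separated (insert v (insert u {x | φ x ≠ none})) ∧
      ∀ x ∈ E, ∀ y, O.Par x y → x = u ∨ y = u → Function.update φ u (some β) x ≠ none →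
        Function.update φ u (some β) y ≠ none →
        O.Bichromatic (Function.update φ u (some β)) x ∨ v ∈ O.K x by
    obtain ⟨v, hv, hsep, hd⟩ := hs
    obtain ⟨γ, hγ⟩ := h.exists_edgesBichromatic_update hu hv hd
    refine ⟨v, γ, hv, ?_, hγ⟩
    rwa [setOf_update_ne_none, setOf_update_ne_none]
  have huS : u ∉ {x | φ x ≠ none} := fun h' => h' hu
  have hS := setOf_update_ne_none φ u β
  set φ₁ := Function.update φ u (some β) with hφ₁
  set S := {x | φ x ≠ none} with hSdef
  have hφ₁u : φ₁ u = some β := Function.update_self ..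
  have hmem : ∀ x, x ∈ insert u S ↔ φ₁ x ≠ none := fun x => by rw [← hS]; rfl
  have hmemS : ∀ x, x ≠ u → φ₁ x ≠ none → x ∈ S := fun x hxu hx => by
    rw [hφ₁, Function.update_of_ne hxu] at hx
    exact hx
  have hchild : ∀ x, O.Par x u → φ₁ x ≠ none → O.Separated (insert u S) := fun x hxu hx =>
    h.separated.insert_of_transGen (hmemS x (fun e => (e ▸ hxu.lt).ne rfl) hx) huS (.single hxu)
  have hparent : ∀ y, O.Par u y → φ₁ y ≠ none → O.Separated (insert u S) := fun y huy hy =>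
    h.separated.insert_of_par_mem fun z hz =>
      hz.unique huy ▸ hmemS y (fun e => (e ▸ huy.lt).ne rfl) hy
  -- If separation fails, `u` has no coloured parent or child. Alice is free to repair separation
  -- alone, since no forest edge at `u` has both ends coloured.
  by_cases hsep : O.Separated (insert u S)
  swap
  · obtain ⟨m, hm, hsepm⟩ := h.separated.exists_insert_insert huS hsep
    refine ⟨m, not_not.1 fun hm' => hm ((hmem m).2 hm'), hsepm, fun x hx y hxy hxyu hx' hy' => ?_⟩
    rcases hxyu with rfl | rfl
    · exact absurd (hparent y hxy hy') hsep
    · exact absurd (hchild x hxy hx') hsep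
  have habove : ∀ v ∈ O.N u, φ₁ v = none → O.Separated (insert v (insert u S)) := fun v hv hv' =>
    hsep.insert_of_transGen (Set.mem_insert u S) (by simpa [hmem] using hv')
      (transGen_par_of_mem_N u v hv)
  -- A spoiled set `K s` of a coloured child `s` has an uncoloured vertex `v`. It differs from `s`
  -- and `u`, so it also lies in `N u`: one move at `v` repairs both `K s` and `K u`, and `v` being
  -- above `u` preserves separation.
  by_cases hbelow : ∃ x ∈ E, O.Par x u ∧ φ₁ x ≠ none ∧ ¬ O.Bichromatic φ₁ x
  · obtain ⟨s, hs, hsu, hs1, hsb⟩ := hbelow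
    obtain ⟨v, hvs, hv⟩ := hleg.exists_eq_none hs hsu.mem_K hφ₁u hsb
    have hvN : v ∈ O.N s := hvs.resolve_left (by rintro rfl; exact hs1 hv)
    have hvu : v ∈ O.N u := hsu.mem_N hvN (by rintro rfl; simp [hφ₁u] at hv)
    refine ⟨v, hv, habove v hvu hv, fun x hx y hxy hxyu hx' hy' => ?_⟩
    rcases hxyu with rfl | rfl
    · exact Or.inr (Set.mem_insert_of_mem _ hvu)
    · have hxs : x = s := h.separated x (hmemS x (fun e => (e ▸ hxy.lt).ne rfl) hx') s
        (hmemS s (fun e => (e ▸ hsu.lt).ne rfl) hs1) y (.single ⟨hxy, huS⟩) (.single ⟨hsu, huS⟩)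
      exact Or.inr (hxs ▸ hvs)
  have hbelow' : ∀ x ∈ E, O.Par x u → φ₁ x ≠ none → O.Bichromatic φ₁ x := by
    intro x hx hxu hx'
    by_contra hb
    exact hbelow ⟨x, hx, hxu, hx', hb⟩
  by_cases habv : u ∈ E ∧ ¬ O.Bichromatic φ₁ u
  · obtain ⟨v, hvu, hv⟩ := hleg.exists_eq_none habv.1 (mem_K_self u) hφ₁u habv.2
    have hvN : v ∈ O.N u := hvu.resolve_left (by rintro rfl; simp [hφ₁u] at hv)
    refine ⟨v, hv, habove v hvN hv, fun x hx y hxy hxyu hx' hy' => ?_⟩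
    rcases hxyu with rfl | rfl
    · exact Or.inr hvu
    · exact Or.inl (hbelow' x hx hxy hx')
  -- Nothing is spoiled; a vertex with no uncoloured parent is a harmless waiting move.
  · obtain ⟨v, hv, hpar⟩ := exists_first_eq_none (O := O) hex
    refine ⟨v, hv, hsep.insert_of_par_mem fun y hy => (hmem y).2 (hpar y hy),
      fun x hx y hxy hxyu hx' hy' => Or.inl ?_⟩
    rcases hxyu with rfl | rfl
    · by_contra hb
      exact habv ⟨hx, hb⟩
    · exact hbelow' x hx hxy hx'

end EliminationOrder

end Strategy

/-! ### From the invariant to the game. -/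

section Game

variable {V : Type*}

theorem isLegalMove_iff [DecidableEq V] {G : SimpleGraph V} {k n : ℕ}
    {φ ψ : PartialColoring V n} : IsLegalMove G k φ ψ ↔
      ∃ v α, φ v = none ∧ ψ = Function.update φ v (some α) ∧ IsCliqueRelaxed G k ψ := by
  constructor
  · rintro ⟨v, hv, ⟨α, hα⟩, hw, hleg⟩
    refine ⟨v, α, hv, ?_, hleg⟩
    ext1 w
    by_cases h : w = v
    · rw [h, hα, Function.update_self]
    · rw [hw w h, Function.update_of_ne h]
  · rintro ⟨v, α, hv, rfl, hleg⟩
    exact ⟨v, hv, ⟨α, Function.update_self ..⟩, fun w hw => Function.update_of_ne hw .., hleg⟩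

theorem isCliqueRelaxed_iff_forall_isNClique {G : SimpleGraph V} {k n : ℕ}
    {φ : PartialColoring V n} : IsCliqueRelaxed G k φ ↔
      ∀ s : Finset V, G.IsNClique (k + 1) s → ∀ α, ∃ x ∈ s, φ x ≠ some α := by
  simp only [IsCliqueRelaxed, SimpleGraph.cliqueFree_induce_iff]
  constructor
  · intro h s hs α
    by_contra! hc
    exact h α (fun x hx => hc x hx) hs
  · intro h α s hsα hs
    obtain ⟨x, hx, hne⟩ := h s hs α
    exact hne (hsα hx)

/-- The vertices `u` that together with their earlier neighbours form a `(k + 1)`-clique of `G`. -/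
def EliminationOrder.fullCliques (O : EliminationOrder V) (G : SimpleGraph V) (k : ℕ) : Set V :=
  {u | (O.N u).card = k ∧ G.IsClique (O.K u)}

/-- A `(k + 1)`-clique lies in `K u` for its last vertex `u`, and equals it because `K u` has at
most `k + 1` elements. The order may come from a supergraph of `G`. -/
theorem EliminationOrder.isCliqueRelaxed_iff (O : EliminationOrder V) {G : SimpleGraph V}
    {k n : ℕ} (hcard : ∀ v, (O.N v).card ≤ k)
    (hadj : ∀ u v, G.Adj u v → O.ord u < O.ord v → u ∈ O.N v) {φ : PartialColoring V n} :
    IsCliqueRelaxed G k φ ↔ O.NoMono (O.fullCliques G k) φ := by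
  classical
  have hcoe : ∀ u, ((insert u (O.N u) : Finset V) : Set V) = O.K u := fun u => by
    simp [EliminationOrder.K]
  have hcd : ∀ u, (insert u (O.N u)).card = (O.N u).card + 1 := fun u =>
    Finset.card_insert_of_notMem fun h => (O.ord_lt u u h).ne rfl
  rw [isCliqueRelaxed_iff_forall_isNClique]
  constructor
  · rintro h u ⟨hu, hcl⟩ α
    obtain ⟨x, hx, hne⟩ := h (insert u (O.N u)) ⟨by rwa [hcoe], by rw [hcd, hu]⟩ α
    exact ⟨x, hcoe u ▸ hx, hne⟩
  · intro h s hs α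
    have hne : s.Nonempty := by
      rw [← Finset.card_pos, hs.card_eq]
      exact k.succ_pos
    obtain ⟨u, hu, hmax⟩ := Finset.exists_max_image s O.ord hne
    have hsub : s ⊆ insert u (O.N u) := by
      intro x hx
      by_cases hxu : x = u
      · exact hxu ▸ Finset.mem_insert_self ..
      · exact Finset.mem_insert_of_mem (hadj x u (hs.isClique hx hu hxu)
          ((hmax x hx).lt_of_ne fun e => hxu (O.ord_inj e)))
    have heq : s = insert u (O.N u) := Finset.eq_of_subset_of_card_le hsub (by
      rw [hcd, hs.card_eq]
      exact Nat.succ_le_succ (hcard u))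
    have hcK : (O.N u).card = k := by
      have := hs.card_eq
      rw [heq, hcd] at this
      omega
    obtain ⟨x, hx, hne⟩ := h u ⟨hcK, by rw [← hcoe, ← heq]; exact hs.isClique⟩ α
    rw [← hcoe, ← heq] at hx
    exact ⟨x, hx, hne⟩

theorem EliminationOrder.aliceWins [Finite V] (O : EliminationOrder V) {G : SimpleGraph V}
    {k : ℕ} (hk : 1 ≤ k) (hcard : ∀ v, (O.N v).card ≤ k)
    (hadj : ∀ u v, G.Adj u v → O.ord u < O.ord v → u ∈ O.N v) : AliceWins G k 4 := by
  classical
  have := Fintype.ofFinite V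
  set E := O.fullCliques G k with hEdef
  have hE : ∀ u ∈ E, (O.N u).Nonempty := fun u hu => by
    rw [← Finset.card_pos, hu.1]
    exact hk
  have hleg : ∀ φ : PartialColoring V 4, IsCliqueRelaxed G k φ ↔ O.NoMono E φ := fun φ =>
    O.isCliqueRelaxed_iff hcard hadj
  -- Induction on the number of uncoloured vertices, one full round at a time.
  have hbob : ∀ (m : ℕ) (φ : PartialColoring V 4),
      (Finset.univ.filter fun v => φ v = none).card = m → O.Safe E φ →
      AliceWinsFrom G k Player.bob φ := by
    intro m
    induction m using Nat.strong_induction_on with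
    | _ m ih =>
    intro φ hm hφ
    by_cases hfin : ∀ v, φ v ≠ none
    · exact .finished _ _ hfin
    push Not at hfin
    obtain ⟨v, hv⟩ := hfin
    refine .bobMove φ ?_ fun ψ hψ => ?_
    · obtain ⟨γ, hγ⟩ := hφ.exists_noMono_update hE hv
      exact ⟨_, isLegalMove_iff.2 ⟨v, γ, hv, rfl, (hleg _).2 hγ⟩⟩
    · obtain ⟨u, β, hu, rfl, hψ⟩ := isLegalMove_iff.1 hψ
      by_cases hfin : ∀ v, Function.update φ u (some β) v ≠ none
      · exact .finished _ _ hfin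
      push Not at hfin
      obtain ⟨w, γ, hw, hsafe⟩ := hφ.exists_reply hu ((hleg _).1 hψ) hfin
      refine .aliceMove _ _ (isLegalMove_iff.2 ⟨w, γ, hw, rfl, (hleg _).2 (hsafe.noMono hE)⟩)
        (ih _ ?_ _ rfl hsafe)
      rw [← hm]
      refine Finset.card_lt_card (Finset.ssubset_iff_of_subset ?_ |>.2 ⟨u, by simp [hu], ?_⟩)
      · intro x
        simp only [Finset.mem_filter, Finset.mem_univ, true_and]
        intro hx
        by_cases hxw : x = w
        · simp [hxw] at hx
        · rw [Function.update_of_ne hxw] at hx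
          by_cases hxu : x = u
          · simp [hxu] at hx
          · rwa [Function.update_of_ne hxu] at hx
      · have huw : u ≠ w := by
          rintro rfl
          simp at hw
        simp [Function.update_of_ne huw]
  have hempty : O.Safe E (fun _ => none : PartialColoring V 4) :=
    ⟨fun w hw => absurd rfl hw, fun u _ y _ hu => absurd rfl hu⟩
  by_cases hfin : ∀ v : V, (none : Option (Fin 4)) ≠ none
  · exact .finished _ _ hfin
  push Not at hfin
  obtain ⟨v, hv, hpar⟩ := EliminationOrder.exists_first_eq_none (O := O)
    (φ := (fun _ => none : PartialColoring V 4)) hfin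
  -- With a single coloured vertex no forest edge has both ends coloured.
  have hsafe : O.Safe E (Function.update (fun _ => none : PartialColoring V 4) v (some 0)) := by
    refine ⟨?_, fun u _ y huy hu hy => ?_⟩
    · rw [EliminationOrder.setOf_update_ne_none]
      exact hempty.separated.insert_of_par_mem hpar
    · have h : ∀ x, Function.update (fun _ => none : PartialColoring V 4) v (some 0) x ≠ none →
          x = v := by
        intro x hx
        by_contra hxv
        simp [hxv] at hx
      exact absurd huy.lt (by rw [h u hu, h y hy]; exact lt_irrefl _)
  exact .aliceMove _ _ (isLegalMove_iff.2 ⟨v, 0, rfl, rfl, (hleg _).2 (hsafe.noMono hE)⟩)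
    (hbob _ _ rfl hsafe)

theorem IsChordal.exists_eliminationOrder [Fintype V] {G : SimpleGraph V} (hG : IsChordal G)
    {k : ℕ} (hk : G.cliqueNum ≤ k + 1) : ∃ O : EliminationOrder V,
      (∀ v, (O.N v).card ≤ k) ∧ ∀ u v, G.Adj u v → O.ord u < O.ord v → u ∈ O.N v := by
  classical
  obtain ⟨ord, -, hinj, hord⟩ := hG.exists_elimination_order_on Finset.univ
  have hN : ∀ u v, u ∈ (Finset.univ.filter fun u => G.Adj u v ∧ ord u < ord v) ↔
      G.Adj u v ∧ ord u < ord v := by simp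
  have hadj : ∀ v x y, G.Adj x v → ord x < ord v → G.Adj y v → ord y < ord v → x ≠ y →
      G.Adj x y := fun v x y hx hxv hy hyv hxy =>
    hord v (Finset.mem_univ _) x (by simpa using hxv) y (by simpa using hyv) hx.symm hy.symm hxy
  refine ⟨⟨ord, fun v => Finset.univ.filter fun u => G.Adj u v ∧ ord u < ord v,
    fun v x hx => ((hN x v).1 hx).2, fun a b h => hinj (by simp) (by simp) h, ?_⟩, ?_, ?_⟩
  · intro v x hx y hy hxy
    obtain ⟨hxa, hxv⟩ := (hN x v).1 hx
    obtain ⟨hya, hyv⟩ := (hN y v).1 hy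
    exact (hN x y).2 ⟨hadj v x y hxa hxv hya hyv (by rintro rfl; exact hxy.ne rfl), hxy⟩
  · intro v
    change (Finset.univ.filter fun u => G.Adj u v ∧ ord u < ord v).card ≤ k
    have hcl : G.IsClique
        (insert v (Finset.univ.filter fun u => G.Adj u v ∧ ord u < ord v) : Finset V) := by
      rw [Finset.coe_insert, SimpleGraph.isClique_insert]
      refine ⟨fun x hx y hy hxy => ?_, fun x hx _ => ((hN x v).1 hx).1.symm⟩
      obtain ⟨hxa, hxv⟩ := (hN x v).1 hx
      obtain ⟨hya, hyv⟩ := (hN y v).1 hy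
      exact hadj v x y hxa hxv hya hyv hxy
    have := hcl.card_le_cliqueNum
    rw [Finset.card_insert_of_notMem (by simp)] at this
    omega
  · exact fun u v huv hlt => (hN u v).2 ⟨huv, hlt⟩

end Game

end CliqueRelaxedGame

theorem mainTheorem1 {V : Type*} [Fintype V] (k : ℕ) (hk : 1 ≤ k) (H : SimpleGraph V)
    (hH : CliqueRelaxedGame.IsPartialKTree k H) :
    CliqueRelaxedGame.AliceWins H k 4 ∧ CliqueRelaxedGame.gameChromaticNumber H k ≤ 4 := by
  obtain ⟨H', hle, hchordal, hnum⟩ := hH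
  obtain ⟨O, hcard, hadj⟩ := hchordal.exists_eliminationOrder hnum.le
  have hwin : CliqueRelaxedGame.AliceWins H k 4 :=
    O.aliceWins hk hcard fun u v huv => hadj u v (hle huv)
  exact ⟨hwin, iInf₂_le 4 hwin⟩
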